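/- Let $2 \le r \le p$ and $n$ be integers and $\sigma \ge 0$. Let $\beta^{(1)},\dots,\beta^{(n)}$ be independent random vectors in $\mathbb{R}^p$ with i.i.d. standard normal entries, and for a symmetric matrix $A\in\mathbb{S}^p$ (the symmetric matrices in $\mathbb{R}^{p\times p}$) let $[\mathcal{X}(A)]_i = (\beta^{(i)})^{\top} A\,\beta^{(i)}$, $i=1,\dots,n$. We observe $y = \mathcal{X}(A)+z$, where $z$ is independent of $\mathcal{X}$ and $z_1,\dots,z_n \overset{\text{i.i.d.}}{\sim} N(0,\sigma^2)$. Write $P_z$, $E_z$ for probability and expectation with respect to $z$, with $\mathcal{X}$ held fixed; $\inf_{\hat A}$ is over all estimators $\hat A$, i.e. all measurable maps $\hat A=\hat A(y)$ from $\mathbb{R}^n$ to $\mathbb{R}^{p\times p}$ (which may depend on $\mathcal{X}$), and $\|\cdot\|_F$ is the Frobenius norm. (1) There is a universal constant $C>0$ (independent of $n,p,r,\sigma$) such that, whenever $n > Crp$, with probability at least $1-26/n$ over $\mathcal{X}$ both of the following hold: $$\inf_{\hat A}\ \sup_{A\in\mathbb{S}^p:\ \operatorname{rank}(A)=r} P_z\Bigl(\|\hat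 A - A\|_F^2 \ge \frac{\sigma^2 rp}{192\,n}\Bigr) \ \ge\ 1 - e^{-pr/192},$$ $$\inf_{\hat A}\ \sup_{A\in\mathbb{S}^p:\ \operatorname{rank}(A)=r} E_z\|\hat A - A\|_F^2 \ \ge\ \frac{\sigma^2 rp}{24\,n}.$$ (2) If $n < \lfloor r/2\rfloor\cdot\lfloor p/2\rfloor$, then for every realization of $\mathcal{X}$ $$\inf_{\hat A}\ \sup_{A\in\mathbb{S}^p:\ \operatorname{rank}(A)=r} E_z\|\hat A - A\|_F^2 = \infty .$$ -/

import Mathlib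

open MeasureTheory ProbabilityTheory
open scoped ENNReal NNReal

noncomputable section

namespace SROP

/-- The law of `n` independent random vectors `β⁽¹⁾, …, β⁽ⁿ⁾` in `ℝᵖ` with i.i.d. entries
drawn from the distribution `P`. -/
def designLaw (P : Measure ℝ) (n p : ℕ) : Measure (Fin n → Fin p → ℝ) :=
  Measure.pi fun _ => Measure.pi fun _ => P

/-- The law of the noise vector `z`, with i.i.d. entries `N(0, σ²)`. -/
def noiseLaw (n : ℕ) (σ : ℝ≥0) : Measure (Fin n → ℝ) :=
  Measure.pi fun _ => gaussianReal 0 (σ ^ 2)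

/-- The symmetric rank-one projections `[𝒳(A)]ᵢ = (β⁽ⁱ⁾)ᵀ A β⁽ⁱ⁾`. -/
def projections {n p : ℕ} (β : Fin n → Fin p → ℝ) (A : Matrix (Fin p) (Fin p) ℝ) :
    Fin n → ℝ :=
  fun i => β i ⬝ᵥ A.mulVec (β i)

/-- The squared Frobenius norm `‖M‖_F²`. -/
def frobeniusSq {p : ℕ} (M : Matrix (Fin p) (Fin p) ℝ) : ℝ :=
  ∑ i, ∑ j, M i j ^ 2

/-- The symmetric `p × p` matrices of rank `r`. -/
def symmetricOfRank (p r : ℕ) : Set (Matrix (Fin p) (Fin p) ℝ) :=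
  {A | A.IsSymm ∧ A.rank = r}

/-- An estimator of `A`: a measurable function of the observation `y ∈ ℝⁿ`. As the minimax
quantities below are taken for a fixed design, it may depend on the design in any way. -/
def Estimator (n p : ℕ) : Type :=
  {f : (Fin n → ℝ) → Matrix (Fin p) (Fin p) ℝ // ∀ i j, Measurable fun y => f y i j}

/-- `inf_Â sup_{A ∈ 𝕊ᵖ, rank A = r} E_z ‖Â(y) - A‖_F²` for the model `y = 𝒳(A) + z` with
fixed design `β`, as an extended nonnegative number. -/
def minimaxRisk {n p : ℕ} (r : ℕ) (σ : ℝ≥0) (β : Fin n → Fin p → ℝ) : ℝ≥0∞ :=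
  ⨅ Ahat : Estimator n p, ⨆ A ∈ symmetricOfRank p r,
    ∫⁻ z, ENNReal.ofReal (frobeniusSq (Ahat.1 (projections β A + z) - A)) ∂(noiseLaw n σ)

/-- `inf_Â sup_{A ∈ 𝕊ᵖ, rank A = r} P_z (‖Â(y) - A‖_F² ≥ t)` for the model `y = 𝒳(A) + z`
with fixed design `β`. -/
def minimaxProb {n p : ℕ} (r : ℕ) (σ : ℝ≥0) (β : Fin n → Fin p → ℝ) (t : ℝ) : ℝ≥0∞ :=
  ⨅ Ahat : Estimator n p, ⨆ A ∈ symmetricOfRank p r,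
    noiseLaw n σ {z | t ≤ frobeniusSq (Ahat.1 (projections β A + z) - A)}

end SROP

end

open MeasureTheory ProbabilityTheory
open scoped ENNReal NNReal

noncomputable section

/-! Both claims come from one family of matrices of rank `r`. With `s = ⌊r/2⌋`, take the symmetric
blocks `[[0, B], [Bᵀ, J Jᵀ]]`, where `B` is `s × (p - s)` and `J` supplies one extra rank when `r`
is odd. The rank is exactly `r` for generic `B`, so the rank constraint contains an affine space, up
to a null set, of dimension `d = s (p - s) ≥ 2rp/9`. On it the model is linear regression with `d`
coefficients.

Lower bounds: put a Gaussian prior on the coefficients and bound the average of `exp (-l * error)`.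
In an eigenbasis of the Gram operator the posterior is a product, so each coordinate costs an
explicit factor (`lintegral_exp_neg_error_le`). By convexity only the trace of the Gram operator
matters (`card_div_le_sum_div`), and Chebyshev's inequality bounds it by `4nd`
(`designLaw_energy_ge`). A moderate `l` gives the probability bound, an `l` of order `1/d` times the
precision gives the risk bound; both follow from `one_le_iSup_lintegral_loss_add`.

Infinite risk: if `n < d`, the regression has a kernel, along which matrices of the same rank move
arbitrarily far apart with unchanged data. -/

namespace SROP

/-! ### Gaussian integrals of exponentials of quadratics. -/

section Gaussian

/-- Integrating the exponential of a quadratic function against a centred Gaussian. -/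
theorem lintegral_exp_quadratic_gaussianReal {v : ℝ≥0} (hv : v ≠ 0) {a : ℝ} (ha : 0 ≤ a)
    (K b : ℝ) :
    ∫⁻ w, ENNReal.ofReal (Real.exp (K + w * b - w ^ 2 * a / 2)) ∂(gaussianReal 0 v) =
      ENNReal.ofReal (Real.exp (K + b ^ 2 / (2 * (a + 1 / v))) * √(1 / (v * (a + 1 / v)))) := by
  have hv0 : (0 : ℝ) < v := by exact_mod_cast pos_iff_ne_zero.mpr hv
  have hh : 0 < a + 1 / (v : ℝ) := by positivity
  set h : ℝ := a + 1 / (v : ℝ) with hdef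
  let u : ℝ≥0 := ⟨1 / h, by positivity⟩
  have hu : u ≠ 0 := by
    intro h0
    have : (1 / h : ℝ) = 0 := congrArg NNReal.toReal h0
    have h1 : 0 < 1 / h := by positivity
    linarith
  rw [gaussianReal_of_var_ne_zero _ hv,
    lintegral_withDensity_eq_lintegral_mul₀ (by fun_prop) (by fun_prop)]
  -- Completing the square: the integrand is a constant times the density of mean `b / h` and
  -- variance `1 / h`.
  have key : ∀ w : ℝ, (gaussianPDF 0 v * fun w =>
      ENNReal.ofReal (Real.exp (K + w * b - w ^ 2 * a / 2))) w =
      ENNReal.ofReal (Real.exp (K + b ^ 2 / (2 * h)) * √(1 / (v * h))) *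
        gaussianPDF (b / h) u w := by
    intro w
    simp only [Pi.mul_apply, gaussianPDF]
    rw [← ENNReal.ofReal_mul (gaussianPDFReal_nonneg _ _ _), ← ENNReal.ofReal_mul (by positivity)]
    congr 1
    rw [gaussianPDFReal, gaussianPDFReal]
    have hu' : (u : ℝ) = 1 / h := rfl
    rw [hu']
    have e1 : (√(2 * Real.pi * v))⁻¹ = √(1 / (v * h)) * (√(2 * Real.pi * (1 / h)))⁻¹ := by
      rw [← Real.sqrt_inv, ← Real.sqrt_inv, ← Real.sqrt_mul (by positivity)]
      congr 1
      field_simp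
    rw [e1]
    have e2 : Real.exp (-(w - 0) ^ 2 / (2 * v)) * Real.exp (K + w * b - w ^ 2 * a / 2) =
        Real.exp (K + b ^ 2 / (2 * h)) * Real.exp (-(w - b / h) ^ 2 / (2 * (1 / h))) := by
      rw [← Real.exp_add, ← Real.exp_add]
      congr 1
      have ha' : a = h - 1 / v := by rw [hdef]; ring
      rw [ha']
      field_simp
      ring
    linear_combination (√(1 / (v * h)) * (√(2 * Real.pi * (1 / h)))⁻¹) * e2
  simp_rw [key]
  rw [lintegral_const_mul _ (by fun_prop), lintegral_gaussianPDF_eq_one _ hu, mul_one]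

/-- Penalising the distance to a point `c` decreases the integral of a Gaussian weight by at least
the factor attained when `c` is the centre of the weight. -/
theorem lintegral_exp_penalized_le {v : ℝ≥0} (hv : v ≠ 0) {a l : ℝ} (ha : 0 ≤ a) (hl : 0 < l)
    (c b : ℝ) :
    ∫⁻ w, ENNReal.ofReal (Real.exp (-l * (c - w) ^ 2) * Real.exp (w * b - w ^ 2 * a / 2))
        ∂(gaussianReal 0 v) ≤
      ENNReal.ofReal (Real.exp (-(l / (a + 1 / v + 2 * l)))) *
        ∫⁻ w, ENNReal.ofReal (Real.exp (w * b - w ^ 2 * a / 2)) ∂(gaussianReal 0 v) := by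
  have hv0 : (0 : ℝ) < v := by exact_mod_cast pos_iff_ne_zero.mpr hv
  have hh : 0 < a + 1 / (v : ℝ) := by positivity
  have e1 : ∀ w : ℝ, Real.exp (-l * (c - w) ^ 2) * Real.exp (w * b - w ^ 2 * a / 2) =
      Real.exp (-l * c ^ 2 + w * (b + 2 * l * c) - w ^ 2 * (a + 2 * l) / 2) := by
    intro w
    rw [← Real.exp_add]
    congr 1
    ring
  have e2 : ∀ w : ℝ, Real.exp (w * b - w ^ 2 * a / 2) =
      Real.exp (0 + w * b - w ^ 2 * a / 2) := by
    intro w; rw [zero_add]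
  simp_rw [e1, e2]
  rw [lintegral_exp_quadratic_gaussianReal hv (by positivity),
    lintegral_exp_quadratic_gaussianReal hv ha, ← ENNReal.ofReal_mul (by positivity)]
  apply ENNReal.ofReal_le_ofReal
  rw [show a + 2 * l + 1 / (v : ℝ) = a + 1 / v + 2 * l by ring]
  set h : ℝ := a + 1 / (v : ℝ) with hdef
  -- The gap is a multiple of `(b - c * h) ^ 2`, so the best `c` is the posterior mean `b / h`.
  have hexp : -l * c ^ 2 + (b + 2 * l * c) ^ 2 / (2 * (h + 2 * l)) ≤ 0 + b ^ 2 / (2 * h) := by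
    have : 0 + b ^ 2 / (2 * h) - (-l * c ^ 2 + (b + 2 * l * c) ^ 2 / (2 * (h + 2 * l))) =
        l * (b - c * h) ^ 2 / (h * (h + 2 * l)) := by
      field_simp
      ring
    have h2 : 0 ≤ l * (b - c * h) ^ 2 / (h * (h + 2 * l)) := by positivity
    linarith
  -- The normalising constants have ratio `√(1 - x)` with `x = 2l / (h + 2l)`, and `1 - x ≤ exp
  -- (-x)`.
  have hsq : √(1 / (v * (h + 2 * l))) ≤
      Real.exp (-(l / (h + 2 * l))) * √(1 / (v * h)) := by
    have h1 : h / (h + 2 * l) ≤ Real.exp (-(2 * l / (h + 2 * l))) := by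
      have := Real.add_one_le_exp (-(2 * l / (h + 2 * l)))
      have h3 : h / (h + 2 * l) = -(2 * l / (h + 2 * l)) + 1 := by field_simp; ring
      linarith
    have h4 : Real.exp (-(2 * l / (h + 2 * l))) = Real.exp (-(l / (h + 2 * l))) ^ 2 := by
      rw [← Real.exp_nat_mul]
      congr 1
      push_cast
      ring
    apply Real.sqrt_le_iff.mpr
    refine ⟨by positivity, ?_⟩
    rw [mul_pow, Real.sq_sqrt (by positivity), ← h4]
    calc 1 / (v * (h + 2 * l)) = h / (h + 2 * l) * (1 / (v * h)) := by field_simp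
      _ ≤ _ := by gcongr
  calc _ ≤ Real.exp (0 + b ^ 2 / (2 * h)) * (Real.exp (-(l / (h + 2 * l))) * √(1 / (v * h))) := by
        gcongr
    _ = _ := by ring

end Gaussian

/-! ### Bayes bound in the Gaussian sequence model. -/

section Bayes

theorem lintegral_pi_prod {ι : Type*} [Fintype ι] (μ : ι → Measure ℝ)
    [∀ i, IsProbabilityMeasure (μ i)] {f : ι → ℝ → ℝ≥0∞} (hf : ∀ i, Measurable (f i)) :
    ∫⁻ y, ∏ i, f i (y i) ∂(Measure.pi μ) = ∏ i, ∫⁻ t, f i t ∂(μ i) := by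
  rw [lintegral_prod_eq_prod_lintegral_of_indepFun Finset.univ (fun i (y : ι → ℝ) => f i (y i))
    (iIndepFun_pi fun i => (hf i).aemeasurable) (fun i => by fun_prop)]
  refine Finset.prod_congr rfl fun i _ => ?_
  exact (measurePreserving_eval μ i).lintegral_comp (hf i)

theorem gaussianReal_eq_withDensity {v : ℝ≥0} (hv : v ≠ 0) (x : ℝ) :
    gaussianReal x v = (gaussianReal 0 v).withDensity
      fun y => ENNReal.ofReal (Real.exp (x * y / v - x ^ 2 / (2 * v))) := by
  have hv0 : (0 : ℝ) < v := by exact_mod_cast pos_iff_ne_zero.mpr hv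
  rw [gaussianReal_of_var_ne_zero _ hv, gaussianReal_of_var_ne_zero _ hv,
    ← withDensity_mul _ (by fun_prop) (by fun_prop)]
  congr 1
  ext y
  simp only [Pi.mul_apply, gaussianPDF]
  rw [← ENNReal.ofReal_mul (gaussianPDFReal_nonneg _ _ _)]
  congr 1
  rw [gaussianPDFReal, gaussianPDFReal, mul_assoc _ (Real.exp _) (Real.exp _), ← Real.exp_add]
  congr 2
  field_simp
  ring

/-- Cameron–Martin formula for a shift of i.i.d. Gaussian noise. -/
theorem lintegral_noiseLaw_add {n : ℕ} {σ : ℝ≥0} (hσ : σ ≠ 0) (x : Fin n → ℝ)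
    {F : (Fin n → ℝ) → ℝ≥0∞} (hF : Measurable F) :
    ∫⁻ z, F (x + z) ∂(noiseLaw n σ) =
      ∫⁻ y, ENNReal.ofReal (Real.exp ((∑ i, x i * y i) / (σ : ℝ) ^ 2 -
        (∑ i, x i ^ 2) / (2 * (σ : ℝ) ^ 2))) * F y ∂(noiseLaw n σ) := by
  have hv : σ ^ 2 ≠ 0 := pow_ne_zero 2 hσ
  let g : Fin n → ℝ → ℝ≥0∞ := fun i y =>
    ENNReal.ofReal (Real.exp (x i * y / (σ ^ 2 : ℝ≥0) - x i ^ 2 / (2 * (σ ^ 2 : ℝ≥0))))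
  have hg : ∀ i, Measurable (g i) := fun i => by fun_prop
  have hgm : Measurable fun y : Fin n → ℝ => ∏ i, g i (y i) :=
    Finset.measurable_prod _ fun i _ => (hg i).comp (measurable_pi_apply i)
  have hmap : (noiseLaw n σ).map (fun z => x + z) =
      (noiseLaw n σ).withDensity fun y => ∏ i, g i (y i) := by
    have h1 : (noiseLaw n σ).map (fun z => x + z) =
        Measure.pi fun i => gaussianReal (x i) (σ ^ 2) := by
      have := Measure.pi_map_pi (μ := fun _ : Fin n => gaussianReal 0 (σ ^ 2))
        (f := fun i t => x i + t) (fun i => by fun_prop)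
      simp only [gaussianReal_map_const_add, zero_add] at this
      exact this
    rw [h1]
    refine Measure.pi_eq fun s hs => ?_
    rw [withDensity_apply _ (MeasurableSet.univ_pi hs),
      ← lintegral_indicator (MeasurableSet.univ_pi hs)]
    have h2 : ∀ y : Fin n → ℝ, (Set.univ.pi s).indicator (fun y => ∏ i, g i (y i)) y =
        ∏ i, (s i).indicator (g i) (y i) := by
      intro y
      by_cases hy : y ∈ Set.univ.pi s
      · rw [Set.indicator_of_mem hy]
        exact Finset.prod_congr rfl fun i _ => (Set.indicator_of_mem (hy i trivial) _).symm
      · rw [Set.indicator_of_notMem hy]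
        obtain ⟨i, hi⟩ : ∃ i, y i ∉ s i := by simpa [Set.mem_pi] using hy
        exact (Finset.prod_eq_zero (Finset.mem_univ i) (Set.indicator_of_notMem hi _)).symm
    simp_rw [h2]
    rw [noiseLaw, lintegral_pi_prod _ fun i => (hg i).indicator (hs i)]
    refine Finset.prod_congr rfl fun i _ => ?_
    rw [gaussianReal_eq_withDensity hv (x i), withDensity_apply _ (hs i),
      lintegral_indicator (hs i)]
  rw [← lintegral_map hF (by fun_prop), hmap, lintegral_withDensity_eq_lintegral_mul _ hgm hF]
  refine lintegral_congr fun y => ?_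
  simp only [Pi.mul_apply, g]
  rw [← ENNReal.ofReal_prod_of_nonneg fun i _ => (Real.exp_pos _).le, ← Real.exp_sum]
  congr 3
  rw [Finset.sum_sub_distrib, ← Finset.sum_div, ← Finset.sum_div]
  push_cast
  rfl

instance (n : ℕ) (σ : ℝ≥0) : IsProbabilityMeasure (noiseLaw n σ) := by
  unfold noiseLaw; infer_instance

/-- In the Gaussian sequence model with a centred Gaussian prior on the coefficients, no estimator
`f` makes the average of `exp (-l * error)` large. -/
theorem lintegral_exp_neg_error_le {ι : Type*} [Fintype ι] {n : ℕ} {σ v : ℝ≥0} (hσ : σ ≠ 0)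
    (hv : v ≠ 0) (x : ι → Fin n → ℝ) (hx : ∀ k k', k ≠ k' → ∑ i, x k i * x k' i = 0)
    {f : (Fin n → ℝ) → ι → ℝ} (hf : Measurable f) {l : ℝ} (hl : 0 < l) :
    ∫⁻ w, ∫⁻ z, ENNReal.ofReal (Real.exp (-l * ∑ k, (f (∑ k, w k • x k + z) k - w k) ^ 2))
        ∂(noiseLaw n σ) ∂(Measure.pi fun _ : ι => gaussianReal 0 v) ≤
      ENNReal.ofReal
        (Real.exp (-∑ k, l / ((∑ i, x k i ^ 2) / (σ : ℝ) ^ 2 + 1 / v + 2 * l))) := by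
  let P : Measure (ι → ℝ) := Measure.pi fun _ => gaussianReal 0 v
  let m : ι → ℝ := fun k => (∑ i, x k i ^ 2) / (σ : ℝ) ^ 2
  let u : (Fin n → ℝ) → ι → ℝ := fun y k => (∑ i, x k i * y i) / (σ : ℝ) ^ 2
  -- The likelihood ratio of the data against pure noise; it factors over `k` because the vectors `x
  -- k` are orthogonal.
  let D : (Fin n → ℝ) → (ι → ℝ) → ℝ≥0∞ := fun y w =>
    ∏ k, ENNReal.ofReal (Real.exp (w k * u y k - w k ^ 2 * m k / 2))
  have hu : Measurable u := by fun_prop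
  have hm : ∀ k, 0 ≤ m k := fun k => by positivity
  have hdens : ∀ (w : ι → ℝ) (y : Fin n → ℝ),
      ENNReal.ofReal (Real.exp ((∑ i, (∑ k, w k • x k) i * y i) / (σ : ℝ) ^ 2 -
        (∑ i, (∑ k, w k • x k) i ^ 2) / (2 * (σ : ℝ) ^ 2))) = D y w := by
    intro w y
    simp only [D]
    rw [← ENNReal.ofReal_prod_of_nonneg fun i _ => (Real.exp_pos _).le, ← Real.exp_sum]
    congr 2
    rw [Finset.sum_sub_distrib]
    congr 1
    · simp only [u, Finset.sum_apply, Pi.smul_apply, smul_eq_mul, Finset.sum_mul]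
      rw [Finset.sum_comm, Finset.sum_div]
      refine Finset.sum_congr rfl fun k _ => ?_
      rw [← mul_div_assoc, Finset.mul_sum]
      simp only [mul_assoc]
    · have h1 : ∑ i, (∑ k, w k • x k) i ^ 2 = ∑ k, w k ^ 2 * ∑ i, x k i ^ 2 := by
        simp only [Finset.sum_apply, Pi.smul_apply, smul_eq_mul, sq, Finset.sum_mul_sum]
        rw [Finset.sum_comm]
        refine Finset.sum_congr rfl fun k _ => ?_
        rw [Finset.sum_comm, Finset.sum_eq_single k]
        · rw [Finset.mul_sum]
          exact Finset.sum_congr rfl fun i _ => by ring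
        · intro k' _ hk'
          have := hx k k' hk'.symm
          calc ∑ i, w k * x k i * (w k' * x k' i) = w k * w k' * ∑ i, x k i * x k' i := by
                rw [Finset.mul_sum]
                exact Finset.sum_congr rfl fun i _ => by ring
            _ = 0 := by rw [this, mul_zero]
        · simp
      rw [h1, Finset.sum_div]
      refine Finset.sum_congr rfl fun k _ => ?_
      simp only [m]
      rw [mul_comm (2 : ℝ), ← div_div, mul_div_assoc]
  have hDm : Measurable fun q : (ι → ℝ) × (Fin n → ℝ) => D q.2 q.1 := by
    refine Finset.measurable_prod _ fun k _ => ?_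
    fun_prop
  have hEm : Measurable fun q : (ι → ℝ) × (Fin n → ℝ) =>
      ENNReal.ofReal (Real.exp (-l * ∑ k, (f q.2 k - q.1 k) ^ 2)) := by fun_prop
  have hone : ∫⁻ y, ∫⁻ w, D y w ∂P ∂(noiseLaw n σ) = 1 := by
    rw [lintegral_lintegral_swap (hDm.comp measurable_swap).aemeasurable]
    have : ∀ w, ∫⁻ y, D y w ∂(noiseLaw n σ) = 1 := by
      intro w
      have := lintegral_noiseLaw_add hσ (∑ k, w k • x k) (F := fun _ => 1) measurable_const
      simp only [hdens, mul_one, lintegral_const, measure_univ] at this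
      exact this.symm
    simp [this, P]
  -- For fixed `y` the estimate `f y` is a constant vector, so the one-dimensional bound applies to
  -- each coordinate separately.
  have hinner : ∀ y, ∫⁻ w, D y w * ENNReal.ofReal (Real.exp (-l * ∑ k, (f y k - w k) ^ 2)) ∂P ≤
      ENNReal.ofReal (Real.exp (-∑ k, l / (m k + 1 / v + 2 * l))) * ∫⁻ w, D y w ∂P := by
    intro y
    have h1 : ∀ w, D y w * ENNReal.ofReal (Real.exp (-l * ∑ k, (f y k - w k) ^ 2)) =
        ∏ k, ENNReal.ofReal (Real.exp (-l * (f y k - w k) ^ 2) *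
          Real.exp (w k * u y k - w k ^ 2 * m k / 2)) := by
      intro w
      rw [Finset.mul_sum, Real.exp_sum, ENNReal.ofReal_prod_of_nonneg fun i _ => (Real.exp_pos _).le,
        ← Finset.prod_mul_distrib]
      refine Finset.prod_congr rfl fun k _ => ?_
      rw [← ENNReal.ofReal_mul (Real.exp_pos _).le, mul_comm]
    simp_rw [h1]
    simp only [P, D]
    rw [lintegral_pi_prod (fun _ : ι => gaussianReal 0 v) (f := fun k t =>
        ENNReal.ofReal (Real.exp (-l * (f y k - t) ^ 2) *
          Real.exp (t * u y k - t ^ 2 * m k / 2))) (fun k => by fun_prop),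
      lintegral_pi_prod (fun _ : ι => gaussianReal 0 v) (f := fun k t =>
        ENNReal.ofReal (Real.exp (t * u y k - t ^ 2 * m k / 2))) (fun k => by fun_prop),
      ← Finset.sum_neg_distrib, Real.exp_sum,
      ENNReal.ofReal_prod_of_nonneg fun i _ => (Real.exp_pos _).le, ← Finset.prod_mul_distrib]
    exact Finset.prod_le_prod' fun k _ => lintegral_exp_penalized_le hv (hm k) hl _ _
  calc _ = ∫⁻ w, ∫⁻ y, D y w * ENNReal.ofReal (Real.exp (-l * ∑ k, (f y k - w k) ^ 2))
        ∂(noiseLaw n σ) ∂P := by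
        refine lintegral_congr fun w => ?_
        rw [lintegral_noiseLaw_add hσ (∑ k, w k • x k)
          (F := fun y => ENNReal.ofReal (Real.exp (-l * ∑ k, (f y k - w k) ^ 2))) (by fun_prop)]
        simp only [hdens]
    _ = ∫⁻ y, ∫⁻ w, D y w * ENNReal.ofReal (Real.exp (-l * ∑ k, (f y k - w k) ^ 2))
        ∂P ∂(noiseLaw n σ) := lintegral_lintegral_swap (hDm.mul hEm).aemeasurable
    _ ≤ ∫⁻ y, ENNReal.ofReal (Real.exp (-∑ k, l / (m k + 1 / v + 2 * l))) * ∫⁻ w, D y w ∂P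
        ∂(noiseLaw n σ) := lintegral_mono hinner
    _ = _ := by
        rw [lintegral_const_mul' _ _ ENNReal.ofReal_ne_top, hone, mul_one]

/-- Jensen's inequality for the exponent in `lintegral_exp_neg_error_le`. -/
theorem card_div_le_sum_div {ι : Type*} [Fintype ι] {h : ι → ℝ} {l H : ℝ} (hl : 0 < l)
    (hh : ∀ k, 0 < h k) (hH : 0 < H) (hsum : ∑ k, h k ≤ Fintype.card ι * H) :
    Fintype.card ι * (l / (H + 2 * l)) ≤ ∑ k, l / (h k + 2 * l) := by
  -- The tangent line at `H` of the convex decreasing function `h ↦ l / (h + 2l)`.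
  have key : ∀ k, l / (H + 2 * l) - l / (H + 2 * l) ^ 2 * (h k - H) ≤ l / (h k + 2 * l) := by
    intro k
    have := hh k
    have e : l / (h k + 2 * l) - (l / (H + 2 * l) - l / (H + 2 * l) ^ 2 * (h k - H)) =
        l * (h k - H) ^ 2 / ((h k + 2 * l) * (H + 2 * l) ^ 2) := by
      field_simp
      ring
    have : 0 ≤ l * (h k - H) ^ 2 / ((h k + 2 * l) * (H + 2 * l) ^ 2) := by positivity
    linarith
  have h1 := Finset.sum_le_sum fun k (_ : k ∈ Finset.univ) => key k
  rw [Finset.sum_sub_distrib, ← Finset.mul_sum, Finset.sum_sub_distrib] at h1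
  simp only [Finset.sum_const, Finset.card_univ, nsmul_eq_mul] at h1
  have h2 : l / (H + 2 * l) ^ 2 * (∑ k, h k - Fintype.card ι * H) ≤ 0 :=
    mul_nonpos_of_nonneg_of_nonpos (by positivity) (by linarith)
  linarith

end Bayes

/-! ### An affine family of symmetric matrices of constant generic rank. -/

section Rank

open Matrix

variable {α γ δ : Type*}

/-- The inclusion matrix of the coordinates `γ` into `α ⊕ (γ ⊕ δ)`. -/
def middleInclusion (α γ δ : Type*) [DecidableEq γ] : Matrix (α ⊕ (γ ⊕ δ)) γ ℝ :=
  fromRows 0 (fromRows 1 0)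

/-- The symmetric block matrix `[[0, B], [Bᵀ, J Jᵀ]]`, where `J` is the inclusion of `γ`. -/
def bordered [Fintype γ] [DecidableEq γ] (B : Matrix α (α ⊕ (γ ⊕ δ)) ℝ) :
    Matrix (α ⊕ (α ⊕ (γ ⊕ δ))) (α ⊕ (α ⊕ (γ ⊕ δ))) ℝ :=
  fromBlocks 0 B Bᵀ (middleInclusion α γ δ * (middleInclusion α γ δ)ᵀ)

theorem bordered_isSymm [Fintype γ] [DecidableEq γ] (B : Matrix α (α ⊕ (γ ⊕ δ)) ℝ) :
    (bordered B).IsSymm := by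
  simp [Matrix.IsSymm, bordered, fromBlocks_transpose, transpose_mul]

/-- The matrix factors through a space of dimension `2|α| + |γ|`. -/
theorem rank_bordered_le [Fintype α] [Fintype γ] [Fintype δ] [DecidableEq α] [DecidableEq γ]
    (B : Matrix α (α ⊕ (γ ⊕ δ)) ℝ) :
    (bordered B).rank ≤ Fintype.card (α ⊕ (α ⊕ γ)) := by
  have : bordered B =
      (fromBlocks 1 0 0 (fromCols Bᵀ (middleInclusion α γ δ)) :
          Matrix (α ⊕ (α ⊕ (γ ⊕ δ))) (α ⊕ (α ⊕ γ)) ℝ) *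
        (fromBlocks 0 B (fromRows 1 0) (fromRows 0 (middleInclusion α γ δ)ᵀ) :
          Matrix (α ⊕ (α ⊕ γ)) (α ⊕ (α ⊕ (γ ⊕ δ))) ℝ) := by
    rw [bordered, fromBlocks_multiply, fromCols_mul_fromRows, fromCols_mul_fromRows]
    simp
  rw [this]
  exact (rank_mul_le_left _ _).trans (rank_le_card_width _)

/-- Deleting the `δ` coordinates leaves `[[0, B₁, B₂], [B₁ᵀ, 0, 0], [B₂ᵀ, 0, 1]]`. If it kills `(a,
b, c)` and `B₁` is invertible, the second row gives `a = 0`, the third `c = 0`, the first `b = 0`.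
-/
theorem le_rank_bordered [Fintype α] [Fintype γ] [Fintype δ] [DecidableEq α] [DecidableEq γ]
    (B : Matrix α (α ⊕ (γ ⊕ δ)) ℝ)
    (hB : IsUnit (B.submatrix id Sum.inl)) :
    Fintype.card (α ⊕ (α ⊕ γ)) ≤ (bordered B).rank := by
  let e : α ⊕ (α ⊕ γ) → α ⊕ (α ⊕ (γ ⊕ δ)) := Sum.map id (Sum.map id Sum.inl)
  have hunit : IsUnit ((bordered B).submatrix e e) := by
    have hS : (bordered B).submatrix e e =
        fromBlocks 0 (fromCols (B.submatrix id Sum.inl) (B.submatrix id (Sum.inr ∘ Sum.inl)))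
          (fromRows (B.submatrix id Sum.inl)ᵀ (B.submatrix id (Sum.inr ∘ Sum.inl))ᵀ)
          (fromBlocks 0 0 0 1) := by
      ext i j
      rcases i with i | i | i <;> rcases j with j | j | j <;>
        simp [e, bordered, middleInclusion, Matrix.one_apply, eq_comm]
    rw [hS, ← mulVec_injective_iff_isUnit]
    refine (injective_iff_map_eq_zero
      (Matrix.mulVecLin (R := ℝ) (fromBlocks 0 (fromCols (B.submatrix id Sum.inl)
        (B.submatrix id (Sum.inr ∘ Sum.inl)))
        (fromRows (B.submatrix id Sum.inl)ᵀ (B.submatrix id (Sum.inr ∘ Sum.inl))ᵀ)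
          (fromBlocks 0 0 0 1)))).mpr ?_
    intro x hx
    obtain ⟨a, y, rfl⟩ : ∃ a y, x = Sum.elim a y :=
      ⟨x ∘ Sum.inl, x ∘ Sum.inr, (Sum.elim_comp_inl_inr x).symm⟩
    obtain ⟨b, c, rfl⟩ : ∃ b c, y = Sum.elim b c :=
      ⟨y ∘ Sum.inl, y ∘ Sum.inr, (Sum.elim_comp_inl_inr y).symm⟩
    have hB' := mulVec_injective_iff_isUnit.mpr hB
    have hBT := mulVec_injective_iff_isUnit.mpr ((Matrix.isUnit_transpose _).mpr hB)
    simp only [mulVecLin_apply, fromBlocks_mulVec, Sum.elim_comp_inl, Sum.elim_comp_inr,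
      fromCols_mulVec, fromRows_mulVec, zero_mulVec, one_mulVec, zero_add, add_zero] at hx
    have h1 : ∀ i, ((B.submatrix id Sum.inl) *ᵥ b +
        (B.submatrix id (Sum.inr ∘ Sum.inl)) *ᵥ c) i = 0 := fun i => congrFun hx (Sum.inl i)
    have h2 : ∀ i, ((B.submatrix id Sum.inl)ᵀ *ᵥ a) i = 0 := fun i => by
      simpa using congrFun hx (Sum.inr (Sum.inl i))
    have h3 : ∀ i, ((B.submatrix id (Sum.inr ∘ Sum.inl))ᵀ *ᵥ a) i + c i = 0 := fun i => by
      simpa using congrFun hx (Sum.inr (Sum.inr i))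
    have ha : a = 0 := hBT (by rw [mulVec_zero]; exact funext h2)
    have hc : c = 0 := by
      ext i
      simpa [ha] using h3 i
    have hb : b = 0 := hB' (by
      rw [mulVec_zero]
      ext i
      simpa [hc] using h1 i)
    subst ha hb hc
    ext i
    rcases i with i | i | i <;> rfl
  rw [← rank_of_isUnit _ hunit]
  exact rank_submatrix_le _ _ _

/-- The matrices `[t • 1, 0, 0] + W / √2`. -/
def shiftedBlock [DecidableEq α] (t : ℝ) (W : α × (α ⊕ (γ ⊕ δ)) → ℝ) : Matrix α (α ⊕ (γ ⊕ δ)) ℝ :=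
  t • fromCols 1 0 + Matrix.of fun i j => W (i, j) / √2

theorem isUnit_shiftedBlock_iff [Fintype α] [DecidableEq α] (t : ℝ) (W : α × (α ⊕ (γ ⊕ δ)) → ℝ) :
    IsUnit ((shiftedBlock t W).submatrix id Sum.inl) ↔
      (-(Matrix.of fun i j => W (i, Sum.inl j) / √2)).charpoly.eval t ≠ 0 := by
  rw [Matrix.isUnit_iff_isUnit_det, isUnit_iff_ne_zero, Matrix.eval_charpoly]
  have : (shiftedBlock t W).submatrix id Sum.inl = Matrix.scalar α t -
      (-(Matrix.of fun i j => W (i, Sum.inl j) / √2)) := by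
    ext i j
    simp [shiftedBlock, Matrix.one_apply, Matrix.diagonal_apply]
  rw [this]

/-- The bad shifts are the roots of a characteristic polynomial. This gives genericity of the rank
through one real parameter. -/
theorem finite_not_isUnit_shiftedBlock [Fintype α] [DecidableEq α]
    (W : α × (α ⊕ (γ ⊕ δ)) → ℝ) :
    {t : ℝ | ¬ IsUnit ((shiftedBlock t W).submatrix id Sum.inl)}.Finite := by
  simp only [isUnit_shiftedBlock_iff, not_not]
  exact Polynomial.finite_setOfPred_isRoot (Matrix.charpoly_monic _).ne_zero

end Rank

/-! ### Reduction of the matrix model to linear regression. -/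

section Embedding

open Matrix

variable {α γ δ : Type*} {p : ℕ}

/-- The symmetric matrices over which the worst case is taken: an affine image of the coefficient
vectors `W`. -/
def probe [Fintype γ] [DecidableEq α] [DecidableEq γ] (e : α ⊕ (α ⊕ (γ ⊕ δ)) ≃ Fin p) (t : ℝ)
    (W : α × (α ⊕ (γ ⊕ δ)) → ℝ) : Matrix (Fin p) (Fin p) ℝ :=
  reindex e e (bordered (shiftedBlock t W))

theorem probe_mem_symmetricOfRank [Fintype α] [Fintype γ] [Fintype δ] [DecidableEq α]
    [DecidableEq γ] (e : α ⊕ (α ⊕ (γ ⊕ δ)) ≃ Fin p) {t : ℝ} {W : α × (α ⊕ (γ ⊕ δ)) → ℝ}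
    (h : IsUnit ((shiftedBlock t W).submatrix id Sum.inl)) :
    probe e t W ∈ symmetricOfRank p (Fintype.card (α ⊕ (α ⊕ γ))) := by
  refine ⟨?_, ?_⟩
  · have := bordered_isSymm (shiftedBlock t W)
    unfold Matrix.IsSymm at this ⊢
    rw [probe, transpose_reindex, this]
  · rw [probe, rank_reindex]
    exact (rank_bordered_le _).antisymm (le_rank_bordered _ h)

/-- The measurement vector of the coefficients of `probe`. -/
def designVec (e : α ⊕ (α ⊕ (γ ⊕ δ)) ≃ Fin p) (b : Fin p → ℝ) :
    EuclideanSpace ℝ (α × (α ⊕ (γ ⊕ δ))) :=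
  WithLp.toLp 2 fun q => √2 * (b (e (Sum.inl q.1)) * b (e (Sum.inr q.2)))

theorem norm_designVec_sq [Fintype α] [Fintype γ] [Fintype δ] (e : α ⊕ (α ⊕ (γ ⊕ δ)) ≃ Fin p)
    (b : Fin p → ℝ) : ‖designVec e b‖ ^ 2 =
      2 * ∑ q : α × (α ⊕ (γ ⊕ δ)), (b (e (Sum.inl q.1)) * b (e (Sum.inr q.2))) ^ 2 := by
  rw [EuclideanSpace.real_norm_sq_eq, Finset.mul_sum]
  refine Finset.sum_congr rfl fun q _ => ?_
  rw [designVec, mul_pow, Real.sq_sqrt (by norm_num)]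

/-- The linear part is a Frobenius isometry: each coefficient occurs twice, divided by `√2`. -/
theorem probe_eq_add [Fintype γ] [DecidableEq α] [DecidableEq γ]
    (e : α ⊕ (α ⊕ (γ ⊕ δ)) ≃ Fin p) (t : ℝ) (W : α × (α ⊕ (γ ⊕ δ)) → ℝ) :
    probe e t W = probe e t 0 + reindex e e (fromBlocks 0 (Matrix.of fun i j => W (i, j) / √2)
      (Matrix.of fun i j => W (i, j) / √2)ᵀ 0) := by
  have h : shiftedBlock t W = shiftedBlock t 0 + Matrix.of fun i j => W (i, j) / √2 := by
    ext i j
    simp [shiftedBlock]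
  have h2 : bordered (shiftedBlock t W) = bordered (shiftedBlock t 0) +
      fromBlocks 0 (Matrix.of fun i j => W (i, j) / √2)
      (Matrix.of fun i j => W (i, j) / √2)ᵀ 0 := by
    rw [h, bordered, bordered, fromBlocks_add, transpose_add]
    simp
  rw [probe, probe, h2]
  rfl

theorem dotProduct_fromBlocks_offDiag {m k : Type*} [Fintype m] [Fintype k] (B : Matrix m k ℝ)
    (x : m → ℝ) (y : k → ℝ) :
    Sum.elim x y ⬝ᵥ fromBlocks 0 B Bᵀ 0 *ᵥ Sum.elim x y = 2 * ∑ i, ∑ j, B i j * (x i * y j) := by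
  rw [fromBlocks_mulVec, Sum.elim_comp_inl, Sum.elim_comp_inr, sumElim_dotProduct_sumElim,
    zero_mulVec, zero_mulVec, zero_add, add_zero, mulVec_transpose, dotProduct_comm y,
    ← dotProduct_mulVec, ← two_mul]
  congr 1
  simp only [dotProduct, mulVec, Finset.mul_sum]
  exact Finset.sum_congr rfl fun i _ => Finset.sum_congr rfl fun j _ => by ring

theorem projections_probe [Fintype α] [Fintype γ] [Fintype δ] [DecidableEq α] [DecidableEq γ]
    {n : ℕ} (β : Fin n → Fin p → ℝ) (e : α ⊕ (α ⊕ (γ ⊕ δ)) ≃ Fin p) (t : ℝ)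
    (W : α × (α ⊕ (γ ⊕ δ)) → ℝ) (i : Fin n) :
    projections β (probe e t W) i =
      projections β (probe e t 0) i + inner ℝ (designVec e (β i)) (WithLp.toLp 2 W) := by
  rw [projections, projections, probe_eq_add e t W, add_mulVec, dotProduct_add]
  congr 1
  have hs : √2 ≠ 0 := by positivity
  have h2 : √2 ^ 2 = 2 := Real.sq_sqrt (by norm_num)
  have hre : ∀ M : Matrix (α ⊕ (α ⊕ (γ ⊕ δ))) (α ⊕ (α ⊕ (γ ⊕ δ))) ℝ,
      β i ⬝ᵥ reindex e e M *ᵥ β i = Sum.elim (fun a => β i (e (Sum.inl a)))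
        (fun c => β i (e (Sum.inr c))) ⬝ᵥ M *ᵥ Sum.elim (fun a => β i (e (Sum.inl a)))
        (fun c => β i (e (Sum.inr c))) := by
    intro M
    have : Sum.elim (fun a => β i (e (Sum.inl a))) (fun c => β i (e (Sum.inr c))) = β i ∘ e := by
      ext a
      cases a <;> rfl
    rw [this, reindex_apply, submatrix_mulVec_equiv, Equiv.symm_symm, dotProduct_comp_equiv_symm]
  rw [hre, dotProduct_fromBlocks_offDiag, PiLp.inner_apply, Fintype.sum_prod_type, Finset.mul_sum]
  refine Finset.sum_congr rfl fun a _ => ?_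
  rw [Finset.mul_sum]
  refine Finset.sum_congr rfl fun c _ => ?_
  simp only [of_apply, designVec, RCLike.inner_apply, conj_trivial]
  field_simp
  linear_combination (-(W (a, c) * β i (e (Sum.inl a)) * β i (e (Sum.inr c)))) * h2

/-- The coefficients, in the parametrisation `probe e t`, of the best approximation of `M`. -/
def probeCoeff [Fintype γ] [DecidableEq α] [DecidableEq γ] (e : α ⊕ (α ⊕ (γ ⊕ δ)) ≃ Fin p)
    (t : ℝ) (M : Matrix (Fin p) (Fin p) ℝ) : EuclideanSpace ℝ (α × (α ⊕ (γ ⊕ δ))) :=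
  WithLp.toLp 2 fun q =>
    ((M - probe e t 0) (e (Sum.inl q.1)) (e (Sum.inr q.2)) +
      (M - probe e t 0) (e (Sum.inr q.2)) (e (Sum.inl q.1))) / √2

/-- Orthogonal projection onto the affine family does not increase the distance to its points. Hence
any matrix estimator, symmetric or not, yields a coefficient estimator that is at least as good. -/
theorem norm_probeCoeff_sub_sq_le [Fintype α] [Fintype γ] [Fintype δ] [DecidableEq α]
    [DecidableEq γ] (e : α ⊕ (α ⊕ (γ ⊕ δ)) ≃ Fin p) (t : ℝ) (M : Matrix (Fin p) (Fin p) ℝ)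
    (W : α × (α ⊕ (γ ⊕ δ)) → ℝ) :
    ‖probeCoeff e t M - WithLp.toLp 2 W‖ ^ 2 ≤ frobeniusSq (M - probe e t W) := by
  set N := M - probe e t W with hN
  have hs : √2 ≠ 0 := by positivity
  have h2 : √2 ^ 2 = 2 := Real.sq_sqrt (by norm_num)
  have hM : M - probe e t 0 = N + reindex e e (fromBlocks 0
      (Matrix.of fun i j => W (i, j) / √2) (Matrix.of fun i j => W (i, j) / √2)ᵀ 0) := by
    rw [hN, probe_eq_add e t W]
    abel
  have hcoord : ∀ q, (probeCoeff e t M - WithLp.toLp 2 W) q =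
      (N (e (Sum.inl q.1)) (e (Sum.inr q.2)) + N (e (Sum.inr q.2)) (e (Sum.inl q.1))) / √2 := by
    intro q
    simp only [probeCoeff, hM, PiLp.sub_apply, Matrix.add_apply, reindex_apply, submatrix_apply,
      Equiv.symm_apply_apply, fromBlocks_apply₁₂, fromBlocks_apply₂₁, transpose_apply, of_apply]
    field_simp
    linear_combination (-W q) * h2
  have hfrob : frobeniusSq N = ∑ a, ∑ b, N (e a) (e b) ^ 2 := by
    rw [frobeniusSq, ← e.sum_comp]
    exact Finset.sum_congr rfl fun a _ => (e.sum_comp _).symm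
  rw [EuclideanSpace.real_norm_sq_eq, hfrob, Fintype.sum_sum_type]
  simp_rw [hcoord]
  rw [Fintype.sum_prod_type]
  calc _ ≤ ∑ i, ∑ j, (N (e (Sum.inl i)) (e (Sum.inr j)) ^ 2 +
        N (e (Sum.inr j)) (e (Sum.inl i)) ^ 2) := by
        refine Finset.sum_le_sum fun i _ => Finset.sum_le_sum fun j _ => ?_
        rw [div_pow, h2]
        nlinarith [sq_nonneg (N (e (Sum.inl i)) (e (Sum.inr j)) -
          N (e (Sum.inr j)) (e (Sum.inl i)))]
    _ = ∑ i, ∑ j, N (e (Sum.inl i)) (e (Sum.inr j)) ^ 2 +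
        ∑ j, ∑ i, N (e (Sum.inr j)) (e (Sum.inl i)) ^ 2 := by
        simp_rw [Finset.sum_add_distrib]
        congr 1
        exact Finset.sum_comm
    _ ≤ _ := by
        refine add_le_add (Finset.sum_le_sum fun i _ => ?_) (Finset.sum_le_sum fun j _ => ?_)
        · rw [Fintype.sum_sum_type (fun b => N (e (Sum.inl i)) (e b) ^ 2)]
          exact le_add_of_nonneg_left (Finset.sum_nonneg fun _ _ => sq_nonneg _)
        · rw [Fintype.sum_sum_type (fun b => N (e (Sum.inr j)) (e b) ^ 2)]
          exact le_add_of_nonneg_right (Finset.sum_nonneg fun _ _ => sq_nonneg _)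

/-- An orthonormal basis in which the rank-one measurements `b i` have diagonal Gram operator. -/
theorem exists_orthonormalBasis_diagonal {E : Type*} [NormedAddCommGroup E]
    [InnerProductSpace ℝ E] [FiniteDimensional ℝ E] {d n : ℕ} (hd : Module.finrank ℝ E = d)
    (b : Fin n → E) :
    ∃ v : OrthonormalBasis (Fin d) ℝ E, ∀ k k', k ≠ k' →
      ∑ i, inner ℝ (b i) (v k) * inner ℝ (b i) (v k') = 0 := by
  -- The Gram operator; the basis comes from the spectral theorem.
  let T : E →ₗ[ℝ] E := ∑ i, (innerₛₗ ℝ (b i)).smulRight (b i)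
  have hTapp : ∀ x y, inner ℝ (T x) y = ∑ i, inner ℝ (b i) x * inner ℝ (b i) y := by
    intro x y
    simp [T, LinearMap.sum_apply, sum_inner, inner_smul_left]
  have hT : T.IsSymmetric := by
    intro x y
    rw [hTapp, real_inner_comm, hTapp]
    exact Finset.sum_congr rfl fun i _ => mul_comm _ _
  refine ⟨hT.eigenvectorBasis hd, fun k k' hk => ?_⟩
  rw [← hTapp, hT.apply_eigenvectorBasis, inner_smul_left,
    (hT.eigenvectorBasis hd).inner_eq_zero hk, mul_zero]

end Embedding

/-! ### From the Bayes bound to minimax bounds; the underdetermined case. -/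

section Minimax

open Matrix

variable {α γ δ : Type*} {p : ℕ}

/-- For a generic shift `t`, almost every matrix `probe e t (f w)` has maximal rank. -/
theorem exists_shift_ae_isUnit [Fintype α] [DecidableEq α] {Ω : Type*} [MeasurableSpace Ω] (P : Measure Ω) [SFinite P]
    {f : Ω → α × (α ⊕ (γ ⊕ δ)) → ℝ} (hf : Measurable f) :
    ∃ t : ℝ, ∀ᵐ w ∂P, IsUnit ((shiftedBlock t (f w)).submatrix id Sum.inl) := by
  have hmeas : MeasurableSet {x : Ω × ℝ |
      IsUnit ((shiftedBlock x.2 (f x.1)).submatrix id Sum.inl)} := by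
    simp only [Matrix.isUnit_iff_isUnit_det, isUnit_iff_ne_zero]
    have : Measurable fun x : Ω × ℝ =>
        ((shiftedBlock x.2 (f x.1)).submatrix id Sum.inl).det := by
      simp only [Matrix.det_apply, Matrix.submatrix_apply, shiftedBlock, Matrix.add_apply,
        Matrix.smul_apply, Matrix.of_apply]
      refine Finset.measurable_sum _ fun s _ => Measurable.const_smul ?_ _
      refine Finset.measurable_prod _ fun i _ => ?_
      have h1 : Measurable fun x : Ω × ℝ => f x.1 (s i, Sum.inl i) :=
        (measurable_pi_apply _).comp (hf.comp measurable_fst)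
      simp only [id]
      exact (measurable_snd.mul_const _).add (h1.div_const _)
    exact (this (measurableSet_singleton 0)).compl
  -- For each `w` only finitely many shifts are bad; Fubini exchanges the quantifiers and yields one
  -- shift good for almost all `w`.
  have h : ∀ᵐ w ∂P, ∀ᵐ t ∂(volume : Measure ℝ),
      IsUnit ((shiftedBlock t (f w)).submatrix id Sum.inl) :=
    Filter.Eventually.of_forall fun w =>
      (finite_not_isUnit_shiftedBlock (f w)).measure_zero volume
  exact ((Measure.ae_ae_comm hmeas).mp h).exists

/-- A lower bound for the minimax risk over symmetric matrices of given rank with respect to a loss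
`φ` that dominates a constant minus an exponential. -/
theorem one_le_iSup_lintegral_loss_add [Fintype α] [Fintype γ] [Fintype δ] [DecidableEq α] [DecidableEq γ]
    {n : ℕ} {σ v : ℝ≥0} (hσ : σ ≠ 0) (hv : v ≠ 0)
    (β : Fin n → Fin p → ℝ) (e : α ⊕ (α ⊕ (γ ⊕ δ)) ≃ Fin p) {l H : ℝ} (hl : 0 < l) (hH : 0 < H)
    (htrace : (∑ i, ‖designVec e (β i)‖ ^ 2) / (σ : ℝ) ^ 2 +
      Fintype.card (α × (α ⊕ (γ ⊕ δ))) / v ≤ Fintype.card (α × (α ⊕ (γ ⊕ δ))) * H)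
    (Ahat : Estimator n p) {φ : ℝ → ℝ≥0∞} {c₁ : ℝ≥0∞} (hc₁ : c₁ ≠ ⊤) {c₂ : ℝ} (hc₂ : 0 ≤ c₂)
    (hφ : ∀ x, 0 ≤ x → 1 ≤ c₁ * φ x + ENNReal.ofReal (c₂ * Real.exp (-l * x))) :
    1 ≤ c₁ * (⨆ A ∈ symmetricOfRank p (Fintype.card (α ⊕ (α ⊕ γ))),
        ∫⁻ z, φ (frobeniusSq (Ahat.1 (projections β A + z) - A)) ∂(noiseLaw n σ)) +
      ENNReal.ofReal
        (c₂ * Real.exp (-(Fintype.card (α × (α ⊕ (γ ⊕ δ))) * (l / (H + 2 * l))))) := by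
  set d := Fintype.card (α × (α ⊕ (γ ⊕ δ))) with hd
  set R := ⨆ A ∈ symmetricOfRank p (Fintype.card (α ⊕ (α ⊕ γ))),
    ∫⁻ z, φ (frobeniusSq (Ahat.1 (projections β A + z) - A)) ∂(noiseLaw n σ) with hR
  let b : Fin n → EuclideanSpace ℝ (α × (α ⊕ (γ ⊕ δ))) := fun i => designVec e (β i)
  obtain ⟨V, hV⟩ := exists_orthonormalBasis_diagonal (d := d) (by simp [hd]) b
  let x : Fin d → Fin n → ℝ := fun k i => inner ℝ (b i) (V k)
  let P : Measure (Fin d → ℝ) := Measure.pi fun _ => gaussianReal 0 v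
  let W : (Fin d → ℝ) → EuclideanSpace ℝ (α × (α ⊕ (γ ⊕ δ))) := fun w => ∑ k, w k • V k
  have hWm : Measurable fun w => WithLp.ofLp (W w) := by
    refine measurable_pi_lambda _ fun q => ?_
    simp only [W, WithLp.ofLp_sum, WithLp.ofLp_smul, Finset.sum_apply, Pi.smul_apply, smul_eq_mul]
    fun_prop
  obtain ⟨t, ht⟩ := exists_shift_ae_isUnit P hWm
  let f : (Fin n → ℝ) → Fin d → ℝ := fun y k =>
    inner ℝ (V k) (probeCoeff e t (Ahat.1 (projections β (probe e t 0) + y)))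
  have hf : Measurable f := by
    refine measurable_pi_lambda _ fun k => ?_
    simp only [f, PiLp.inner_apply, RCLike.inner_apply, conj_trivial, probeCoeff, Matrix.sub_apply]
    refine Finset.measurable_sum _ fun q _ => ?_
    have hA : ∀ i j, Measurable fun y => Ahat.1 (projections β (probe e t 0) + y) i j :=
      fun i j => (Ahat.2 i j).comp (measurable_const_add _)
    exact ((((hA _ _).sub_const _).add ((hA _ _).sub_const _)).div_const _).mul_const _
  have hproj : ∀ w, projections β (probe e t (W w)) =
      projections β (probe e t 0) + ∑ k, w k • x k := by
    intro w
    ext i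
    rw [projections_probe]
    simp [W, x, b, inner_sum, inner_smul_right]
  have herr : ∀ w z, ∑ k, (f (∑ k, w k • x k + z) k - w k) ^ 2 ≤
      frobeniusSq (Ahat.1 (projections β (probe e t (W w)) + z) - probe e t (W w)) := by
    intro w z
    refine le_trans (le_of_eq ?_) (norm_probeCoeff_sub_sq_le e t _ _)
    rw [← V.sum_sq_norm_inner_right]
    refine Finset.sum_congr rfl fun k _ => ?_
    rw [Real.norm_eq_abs, sq_abs, inner_sub_right, hproj, add_assoc]
    congr 2
    simp [W, inner_sum, inner_smul_right, V.inner_eq_ite]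
  have hgm : ∀ w : Fin d → ℝ, Measurable fun z =>
      ENNReal.ofReal (Real.exp (-l * ∑ k, (f (∑ k, w k • x k + z) k - w k) ^ 2)) := by
    intro w
    fun_prop
  have hpoint : ∀ᵐ w ∂P, 1 ≤ c₁ * R + ENNReal.ofReal c₂ * ∫⁻ z, ENNReal.ofReal
      (Real.exp (-l * ∑ k, (f (∑ k, w k • x k + z) k - w k) ^ 2)) ∂(noiseLaw n σ) := by
    filter_upwards [ht] with w hw
    have hmem := probe_mem_symmetricOfRank e hw
    have hle : ∫⁻ z, φ (frobeniusSq (Ahat.1 (projections β (probe e t (W w)) + z) -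
        probe e t (W w))) ∂(noiseLaw n σ) ≤ R :=
      le_iSup₂ (f := fun A _ => ∫⁻ z, φ (frobeniusSq (Ahat.1 (projections β A + z) - A))
        ∂(noiseLaw n σ)) _ hmem
    calc (1 : ℝ≥0∞) = ∫⁻ _, 1 ∂(noiseLaw n σ) := by simp
      _ ≤ ∫⁻ z, (c₁ * φ (frobeniusSq (Ahat.1 (projections β (probe e t (W w)) + z) -
            probe e t (W w))) + ENNReal.ofReal c₂ * ENNReal.ofReal
          (Real.exp (-l * ∑ k, (f (∑ k, w k • x k + z) k - w k) ^ 2))) ∂(noiseLaw n σ) := by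
        refine lintegral_mono fun z => ?_
        refine (hφ (frobeniusSq (Ahat.1 (projections β (probe e t (W w)) + z) -
            probe e t (W w))) (Finset.sum_nonneg fun _ _ => Finset.sum_nonneg fun _ _ =>
              sq_nonneg _)).trans ?_
        gcongr
        rw [← ENNReal.ofReal_mul hc₂]
        refine ENNReal.ofReal_le_ofReal (mul_le_mul_of_nonneg_left (Real.exp_le_exp.mpr ?_) hc₂)
        have := herr w z
        nlinarith
      _ ≤ _ := by
        -- Only the exponential summand has to be measurable, so `φ` may be arbitrary.
        rw [lintegral_add_right _ ((hgm w).const_mul _), lintegral_const_mul' _ _ hc₁,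
          lintegral_const_mul' _ _ ENNReal.ofReal_ne_top]
        gcongr
  have hbayes := lintegral_exp_neg_error_le hσ hv x hV hf hl
  have hsum : ∑ k, ((∑ i, x k i ^ 2) / (σ : ℝ) ^ 2 + 1 / v) ≤ Fintype.card (Fin d) * H := by
    rw [Finset.sum_add_distrib, ← Finset.sum_div, Finset.sum_comm, Fintype.card_fin]
    -- Parseval: the trace does not depend on the eigenbasis.
    have : ∀ i, ∑ k, x k i ^ 2 = ‖b i‖ ^ 2 := by
      intro i
      rw [← V.sum_sq_norm_inner_left]
      exact Finset.sum_congr rfl fun k _ => by rw [Real.norm_eq_abs, sq_abs]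
    simp_rw [this]
    refine le_trans (le_of_eq ?_) htrace
    simp [b, div_eq_mul_inv]
  have hexp := card_div_le_sum_div hl (fun k => by
    have : (0 : ℝ) < v := by exact_mod_cast pos_iff_ne_zero.mpr hv
    positivity) hH hsum
  rw [Fintype.card_fin] at hexp
  calc (1 : ℝ≥0∞) = ∫⁻ _, 1 ∂P := by simp [P]
    _ ≤ ∫⁻ w, (c₁ * R + ENNReal.ofReal c₂ * ∫⁻ z, ENNReal.ofReal
      (Real.exp (-l * ∑ k, (f (∑ k, w k • x k + z) k - w k) ^ 2)) ∂(noiseLaw n σ)) ∂P :=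
        lintegral_mono_ae hpoint
    _ = c₁ * R + ENNReal.ofReal c₂ * ∫⁻ w, ∫⁻ z, ENNReal.ofReal
      (Real.exp (-l * ∑ k, (f (∑ k, w k • x k + z) k - w k) ^ 2)) ∂(noiseLaw n σ) ∂P := by
        rw [lintegral_add_left measurable_const, lintegral_const_mul' _ _ ENNReal.ofReal_ne_top]
        simp [P]
    _ ≤ _ := by
        rw [ENNReal.ofReal_mul hc₂]
        gcongr
        exact hbayes.trans (ENNReal.ofReal_le_ofReal (Real.exp_le_exp.mpr (neg_le_neg hexp)))

/-- If there are fewer measurements than free parameters, two matrices of the same rank that are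
arbitrarily far apart have the same measurements. -/
theorem exists_projections_eq_far [Fintype α] [Fintype γ] [Fintype δ] [DecidableEq α] [DecidableEq γ]
    {n : ℕ} (β : Fin n → Fin p → ℝ)
    (e : α ⊕ (α ⊕ (γ ⊕ δ)) ≃ Fin p) (hn : n < Fintype.card (α × (α ⊕ (γ ⊕ δ)))) (N : ℝ) :
    ∃ A ∈ symmetricOfRank p (Fintype.card (α ⊕ (α ⊕ γ))),
      ∃ B ∈ symmetricOfRank p (Fintype.card (α ⊕ (α ⊕ γ))),
        projections β A = projections β B ∧ N ≤ frobeniusSq (A - B) := by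
  let T : EuclideanSpace ℝ (α × (α ⊕ (γ ⊕ δ))) →ₗ[ℝ] (Fin n → ℝ) :=
    LinearMap.pi fun i => innerₛₗ ℝ (designVec e (β i))
  obtain ⟨w, hw, hw0⟩ := (LinearMap.ker T).ne_bot_iff.mp
    (LinearMap.ker_ne_bot_of_finrank_lt (f := T) (by simpa using hn))
  have hker : ∀ i, inner ℝ (designVec e (β i)) w = 0 := fun i => congrFun hw i
  have hpos : 0 < ‖w‖ := norm_pos_iff.mpr hw0
  -- Scaled so that `‖s • w‖ ^ 2 = max N 0`; then `t` is chosen good for both endpoints `0` and `s •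
  -- w`.
  let s : ℝ := √(max N 0) / ‖w‖
  have hfin := (finite_not_isUnit_shiftedBlock (0 : α × (α ⊕ (γ ⊕ δ)) → ℝ)).union
    (finite_not_isUnit_shiftedBlock (WithLp.ofLp (s • w)))
  obtain ⟨t, ht⟩ := hfin.infinite_compl.nonempty
  simp only [Set.mem_compl_iff, Set.mem_union, Set.mem_ofPred_eq, not_or, not_not] at ht
  refine ⟨probe e t (s • w), probe_mem_symmetricOfRank e ht.2, probe e t 0,
    probe_mem_symmetricOfRank e ht.1, ?_, ?_⟩
  · ext i
    rw [projections_probe]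
    have : (WithLp.toLp 2 (s • WithLp.ofLp w) : EuclideanSpace ℝ (α × (α ⊕ (γ ⊕ δ)))) =
      s • w := rfl
    rw [this, inner_smul_right, hker, mul_zero, add_zero]
  · have h := norm_probeCoeff_sub_sq_le e t (probe e t 0) (s • w)
    have h0 : probeCoeff e t (probe e t 0) = 0 := by
      ext q
      simp [probeCoeff]
    have h1 : (WithLp.toLp 2 (s • WithLp.ofLp w) : EuclideanSpace ℝ (α × (α ⊕ (γ ⊕ δ)))) =
      s • w := rfl
    rw [h0, h1, zero_sub, norm_neg, norm_smul, Real.norm_of_nonneg (by positivity)] at h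
    have h2 : s * ‖w‖ = √(max N 0) := div_mul_cancel₀ _ hpos.ne'
    rw [h2, Real.sq_sqrt (le_max_right _ _)] at h
    refine (le_max_left N 0).trans (h.trans (le_of_eq ?_))
    simp only [frobeniusSq, Matrix.sub_apply]
    exact Finset.sum_congr rfl fun i _ => Finset.sum_congr rfl fun j _ => by ring

/-- Two-point argument: `A` and `B` give the same data, and `‖A - B‖² ≤ 2‖M - A‖² + 2‖M - B‖²` for
every estimate `M`, so the worst-case risk is at least `N / 4`. -/
theorem minimaxRisk_eq_top_of_far {n r : ℕ} (σ : ℝ≥0) (β : Fin n → Fin p → ℝ)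
    (h : ∀ N : ℝ, ∃ A ∈ symmetricOfRank p r, ∃ B ∈ symmetricOfRank p r,
      projections β A = projections β B ∧ N ≤ frobeniusSq (A - B)) :
    minimaxRisk r σ β = ⊤ := by
  rw [minimaxRisk, iInf_eq_top]
  intro Ahat
  set R := ⨆ A ∈ symmetricOfRank p r,
    ∫⁻ z, ENNReal.ofReal (frobeniusSq (Ahat.1 (projections β A + z) - A)) ∂(noiseLaw n σ) with hR
  have hle : ∀ A ∈ symmetricOfRank p r, ∫⁻ z, ENNReal.ofReal
      (frobeniusSq (Ahat.1 (projections β A + z) - A)) ∂(noiseLaw n σ) ≤ R := fun A hA =>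
    le_iSup₂ (f := fun A _ => ∫⁻ z, ENNReal.ofReal
      (frobeniusSq (Ahat.1 (projections β A + z) - A)) ∂(noiseLaw n σ)) A hA
  have hbound : ∀ N : ℝ, ENNReal.ofReal N ≤ 2 * R + 2 * R := by
    intro N
    obtain ⟨A, hA, B, hB, hAB, hN⟩ := h N
    have hmeas : Measurable fun z => ENNReal.ofReal
        (frobeniusSq (Ahat.1 (projections β B + z) - B)) := by
      refine ENNReal.measurable_ofReal.comp ?_
      refine Finset.measurable_sum _ fun i _ => Finset.measurable_sum _ fun j _ => ?_
      exact (((Ahat.2 i j).comp (measurable_const_add _)).sub_const _).pow_const 2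
    have hpt : ∀ M : Matrix (Fin p) (Fin p) ℝ, N ≤ 2 * frobeniusSq (M - A) +
        2 * frobeniusSq (M - B) := by
      intro M
      refine hN.trans ?_
      simp only [frobeniusSq, Finset.mul_sum, ← Finset.sum_add_distrib, Matrix.sub_apply]
      refine Finset.sum_le_sum fun i _ => Finset.sum_le_sum fun j _ => ?_
      nlinarith [sq_nonneg ((M i j - A i j) + (M i j - B i j))]
    have hnn : ∀ M : Matrix (Fin p) (Fin p) ℝ, 0 ≤ frobeniusSq M := fun M =>
      Finset.sum_nonneg fun _ _ => Finset.sum_nonneg fun _ _ => sq_nonneg _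
    calc ENNReal.ofReal N = ∫⁻ _, ENNReal.ofReal N ∂(noiseLaw n σ) := by simp
      _ ≤ ∫⁻ z, (2 * ENNReal.ofReal (frobeniusSq (Ahat.1 (projections β A + z) - A)) +
          2 * ENNReal.ofReal (frobeniusSq (Ahat.1 (projections β B + z) - B)))
            ∂(noiseLaw n σ) := by
        refine lintegral_mono fun z => ?_
        rw [hAB]
        refine (ENNReal.ofReal_le_ofReal (hpt (Ahat.1 (projections β B + z)))).trans ?_
        rw [ENNReal.ofReal_add (mul_nonneg zero_le_two (hnn _)) (mul_nonneg zero_le_two (hnn _)),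
          ENNReal.ofReal_mul zero_le_two, ENNReal.ofReal_mul zero_le_two]
        simp
      _ ≤ _ := by
        rw [lintegral_add_right _ (hmeas.const_mul _), lintegral_const_mul' _ _ (by simp),
          lintegral_const_mul' _ _ (by simp)]
        gcongr
        · exact hle A hA
        · exact hle B hB
  by_contra hne
  have hfin : 2 * R + 2 * R ≠ ⊤ := by finiteness
  have := hbound ((2 * R + 2 * R).toReal + 1)
  rw [ENNReal.ofReal_le_iff_le_toReal hfin] at this
  linarith

end Minimax

/-! ### Moments of the design and Chebyshev's inequality. -/

section Concentration

theorem integral_sq_gaussianReal : ∫ t, t ^ 2 ∂(gaussianReal 0 1) = 1 := by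
  have h := variance_fun_id_gaussianReal (μ := 0) (v := 1)
  rw [variance_of_integral_eq_zero (by fun_prop) (by simp)] at h
  simpa using h

theorem integral_pow_four_gaussianReal : ∫ t, t ^ 4 ∂(gaussianReal 0 1) = 3 := by
  have h := iteratedDeriv_mgf_zero (X := id) (μ := gaussianReal 0 1)
    (by simp [integrableExpSet_id_gaussianReal]) 4
  have hE : ∀ t : ℝ, HasDerivAt (fun t : ℝ => Real.exp (t ^ 2 / 2)) (t * Real.exp (t ^ 2 / 2)) t := by
    intro t
    have := ((hasDerivAt_pow 2 t).div_const 2).exp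
    refine this.congr_deriv ?_
    simp [mul_comm]
  -- Derivatives of the moment generating function stay of the form polynomial times `exp (t ^ 2 /
  -- 2)`, with `P ↦ P' + X P`.
  have hP : ∀ P : Polynomial ℝ, deriv (fun t => P.eval t * Real.exp (t ^ 2 / 2)) =
      fun t => (P.derivative + Polynomial.X * P).eval t * Real.exp (t ^ 2 / 2) := by
    intro P
    ext t
    refine (((P.hasDerivAt t).mul (hE t)).congr_deriv ?_).deriv
    simp only [Polynomial.eval_add, Polynomial.eval_mul, Polynomial.eval_X]
    ring
  have hm : mgf id (gaussianReal 0 1) =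
      fun t : ℝ => (1 : Polynomial ℝ).eval t * Real.exp (t ^ 2 / 2) := by
    rw [mgf_id_gaussianReal]
    simp
  rw [hm, iteratedDeriv_succ', iteratedDeriv_succ', iteratedDeriv_succ', iteratedDeriv_succ',
    iteratedDeriv_zero, hP, hP, hP, hP] at h
  simp at h
  rw [← h]
  norm_num

theorem integrable_pow_gaussianReal (k : ℕ) : Integrable (fun t : ℝ => t ^ k) (gaussianReal 0 1) := by
  have := (memLp_id_gaussianReal (μ := 0) (v := 1) k).integrable_norm_pow'
  refine (integrable_norm_iff (by fun_prop)).mp ?_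
  simpa [norm_pow] using this

theorem indepFun_eval_pow {p : ℕ} {i j : Fin p} (hij : i ≠ j) (k : ℕ) :
    IndepFun (fun b : Fin p → ℝ => b i ^ k) (fun b => b j ^ k)
      (Measure.pi fun _ => gaussianReal 0 1) :=
  (iIndepFun_pi (μ := fun _ : Fin p => gaussianReal 0 1) (X := fun _ t => t ^ k)
    fun _ => by fun_prop).indepFun hij

theorem integral_eval_pow {p : ℕ} (i : Fin p) (k : ℕ) :
    ∫ b : Fin p → ℝ, b i ^ k ∂(Measure.pi fun _ => gaussianReal 0 1) =
      ∫ t, t ^ k ∂(gaussianReal 0 1) :=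
  integral_comp_eval (μ := fun _ : Fin p => gaussianReal 0 1) (f := fun t : ℝ => t ^ k)
    (by fun_prop)

theorem integrable_eval_pow_mul {p : ℕ} {i j : Fin p} (hij : i ≠ j) (k : ℕ) :
    Integrable (fun b : Fin p → ℝ => b i ^ k * b j ^ k)
      (Measure.pi fun _ => gaussianReal 0 1) := by
  have h : ∀ i : Fin p, Integrable (fun b : Fin p → ℝ => b i ^ k)
      (Measure.pi fun _ => gaussianReal 0 1) := fun i =>
    integrable_comp_eval (μ := fun _ : Fin p => gaussianReal 0 1) (integrable_pow_gaussianReal k)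
  exact (indepFun_eval_pow hij k).integrable_mul (h i) (h j)

theorem integral_eval_pow_mul {p : ℕ} {i j : Fin p} (hij : i ≠ j) (k : ℕ) :
    ∫ b : Fin p → ℝ, b i ^ k * b j ^ k ∂(Measure.pi fun _ => gaussianReal 0 1) =
      (∫ t, t ^ k ∂(gaussianReal 0 1)) ^ 2 := by
  rw [(indepFun_eval_pow hij k).integral_fun_mul_eq_mul_integral
      ((measurable_pi_apply i).pow_const k).aestronglyMeasurable
      ((measurable_pi_apply j).pow_const k).aestronglyMeasurable,
    integral_eval_pow, integral_eval_pow, sq]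

variable {p : ℕ} {Q : Type*} [Fintype Q] {f g : Q → Fin p}

theorem memLp_sum_sq_mul (hfg : ∀ q, f q ≠ g q) :
    MemLp (fun b : Fin p → ℝ => ∑ q, (b (f q) * b (g q)) ^ 2) 2
      (Measure.pi fun _ => gaussianReal 0 1) := by
  refine memLp_finsetSum _ fun q _ => ?_
  rw [memLp_two_iff_integrable_sq (by fun_prop)]
  refine (integrable_eval_pow_mul (hfg q) 4).congr (Filter.Eventually.of_forall fun b => ?_)
  ring

theorem integral_sum_sq_mul (hfg : ∀ q, f q ≠ g q) :
    ∫ b : Fin p → ℝ, ∑ q, (b (f q) * b (g q)) ^ 2 ∂(Measure.pi fun _ => gaussianReal 0 1) =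
      Fintype.card Q := by
  simp_rw [mul_pow]
  rw [integral_finsetSum _ fun q _ => integrable_eval_pow_mul (hfg q) 2]
  simp_rw [fun q => integral_eval_pow_mul (hfg q) 2, integral_sq_gaussianReal]
  simp

/-- The summands may share coordinates, so independence is replaced by Cauchy–Schwarz; each product
of fourth powers has mean `3 * 3`. -/
theorem variance_sum_sq_mul_le (hfg : ∀ q, f q ≠ g q) :
    Var[fun b : Fin p → ℝ => ∑ q, (b (f q) * b (g q)) ^ 2;
      Measure.pi fun _ => gaussianReal 0 1] ≤ 9 * (Fintype.card Q : ℝ) ^ 2 := by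
  refine (variance_le_expectation_sq (by fun_prop)).trans ?_
  calc _ ≤ ∫ b : Fin p → ℝ, Fintype.card Q * ∑ q, b (f q) ^ 4 * b (g q) ^ 4
        ∂(Measure.pi fun _ => gaussianReal 0 1) := by
        refine integral_mono (memLp_sum_sq_mul hfg).integrable_sq
          ((integrable_finsetSum _ fun q _ => integrable_eval_pow_mul (hfg q) 4).const_mul _)
          fun b => ?_
        have := sq_sum_le_card_mul_sum_sq (s := Finset.univ) (f := fun q => (b (f q) * b (g q)) ^ 2)
        refine this.trans (le_of_eq ?_)
        rw [Finset.card_univ]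
        congr 1
        exact Finset.sum_congr rfl fun q _ => by ring
    _ = _ := by
        rw [integral_const_mul, integral_finsetSum _ fun q _ => integrable_eval_pow_mul (hfg q) 4]
        simp_rw [fun q => integral_eval_pow_mul (hfg q) 4, integral_pow_four_gaussianReal]
        simp
        ring

/-- Chebyshev's inequality for the total energy of the coordinates `β (f q) * β (g q)`. -/
theorem designLaw_energy_ge {n : ℕ} (hn : 0 < n) (hQ : 0 < Fintype.card Q)
    (hfg : ∀ q, f q ≠ g q) :
    ENNReal.ofReal (1 - 26 / (n : ℝ)) ≤ designLaw (gaussianReal 0 1) n p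
      {β | ∑ i, ∑ q, (β i (f q) * β i (g q)) ^ 2 ≤ 2 * n * Fintype.card Q} := by
  have hn0 : (0 : ℝ) < n := by exact_mod_cast hn
  have hd0 : (0 : ℝ) < Fintype.card Q := by exact_mod_cast hQ
  let w : (Fin p → ℝ) → ℝ := fun b => ∑ q, (b (f q) * b (g q)) ^ 2
  let μ : Measure (Fin p → ℝ) := Measure.pi fun _ => gaussianReal 0 1
  have hw : MemLp w 2 μ := memLp_sum_sq_mul hfg
  let X : (Fin n → Fin p → ℝ) → ℝ := fun β => ∑ i, w (β i)
  have hwi : ∀ i, MemLp (fun β : Fin n → Fin p → ℝ => w (β i)) 2 (Measure.pi fun _ => μ) :=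
    fun i => hw.comp_measurePreserving (measurePreserving_eval (fun _ : Fin n => μ) i)
  have hX : MemLp X 2 (Measure.pi fun _ => μ) := memLp_finsetSum _ fun i _ => hwi i
  have hmean : ∫ β, X β ∂(Measure.pi fun _ => μ) = n * Fintype.card Q := by
    simp only [X]
    rw [integral_finsetSum _ fun i _ => (hwi i).integrable (by norm_num)]
    have : ∀ i : Fin n, ∫ β : Fin n → Fin p → ℝ, w (β i) ∂(Measure.pi fun _ => μ) =
        Fintype.card Q := fun i => by
      rw [integral_comp_eval (μ := fun _ : Fin n => μ) (f := w) hw.aestronglyMeasurable]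
      exact integral_sum_sq_mul hfg
    simp [this]
  have hvar : Var[X; Measure.pi fun _ => μ] ≤ n * (9 * (Fintype.card Q : ℝ) ^ 2) := by
    have h := variance_sum_pi (μ := fun _ : Fin n => μ) (X := fun _ => w) fun _ => hw
    have hX' : (∑ i, fun β : Fin n → Fin p → ℝ => w (β i)) = X := by
      ext β
      simp [X]
    rw [hX'] at h
    rw [h]
    simp only [Finset.sum_const, Finset.card_univ, Fintype.card_fin, nsmul_eq_mul]
    exact mul_le_mul_of_nonneg_left (variance_sum_sq_mul_le hfg) hn0.le
  -- Deviating by the mean itself has probability at most `9 / n`, within the allowed `26 / n`.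
  have hcheb := meas_ge_le_variance_div_sq hX (c := n * Fintype.card Q) (by positivity)
  set G : Set (Fin n → Fin p → ℝ) :=
    {β | ∑ i, ∑ q, (β i (f q) * β i (g q)) ^ 2 ≤ 2 * n * Fintype.card Q} with hG
  have hGm : MeasurableSet G := measurableSet_le (by fun_prop) measurable_const
  have hsub : Gᶜ ⊆ {β | n * Fintype.card Q ≤ |X β - ∫ β, X β ∂(Measure.pi fun _ => μ)|} := by
    intro β hβ
    have hβ' : 2 * n * Fintype.card Q < X β := not_le.mp hβ
    change n * (Fintype.card Q : ℝ) ≤ |_|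
    rw [hmean]
    exact le_trans (by linarith) (le_abs_self _)
  have hcompl : designLaw (gaussianReal 0 1) n p Gᶜ ≤ ENNReal.ofReal (26 / n) := by
    refine (measure_mono hsub).trans (hcheb.trans (ENNReal.ofReal_le_ofReal ?_))
    rw [div_le_div_iff₀ (by positivity) hn0]
    have : 0 < (n : ℝ) * (Fintype.card Q : ℝ) ^ 2 * n := by positivity
    nlinarith
  have : IsProbabilityMeasure (designLaw (gaussianReal 0 1) n p) := by
    unfold designLaw
    infer_instance
  have h1 := prob_add_prob_compl (μ := designLaw (gaussianReal 0 1) n p) hGm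
  rw [ENNReal.ofReal_sub _ (by positivity), ENNReal.ofReal_one, tsub_le_iff_right, ← h1]
  gcongr

end Concentration

/-! ### Choice of constants. -/

section MinimaxBounds

variable {α γ δ : Type*} {p : ℕ}

theorem frobeniusSq_nonneg (M : Matrix (Fin p) (Fin p) ℝ) : 0 ≤ frobeniusSq M :=
  Finset.sum_nonneg fun _ _ => Finset.sum_nonneg fun _ _ => sq_nonneg _

theorem symmetricOfRank_nonempty [Fintype α] [Fintype γ] [Fintype δ] [DecidableEq α]
    [DecidableEq γ] (e : α ⊕ (α ⊕ (γ ⊕ δ)) ≃ Fin p) :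
    (symmetricOfRank p (Fintype.card (α ⊕ (α ⊕ γ)))).Nonempty := by
  obtain ⟨t, ht⟩ :=
    (finite_not_isUnit_shiftedBlock (0 : α × (α ⊕ (γ ⊕ δ)) → ℝ)).infinite_compl.nonempty
  exact ⟨_, probe_mem_symmetricOfRank e (not_not.mp ht)⟩

/-- The lower bounds on the minimax risk for a design whose total energy is controlled. -/
theorem minimax_lower_bounds [Fintype α] [Fintype γ] [Fintype δ] [DecidableEq α] [DecidableEq γ]
    {n : ℕ} (hn : 0 < n) (σ : ℝ≥0) (β : Fin n → Fin p → ℝ) (e : α ⊕ (α ⊕ (γ ⊕ δ)) ≃ Fin p)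
    (hd : 0 < Fintype.card (α × (α ⊕ (γ ⊕ δ)))) {κ : ℝ}
    (hκ : 2 / 9 * κ ≤ Fintype.card (α × (α ⊕ (γ ⊕ δ))))
    (hβ : ∑ i, ∑ q : α × (α ⊕ (γ ⊕ δ)),
      (β i (e (Sum.inl q.1)) * β i (e (Sum.inr q.2))) ^ 2 ≤
        2 * n * Fintype.card (α × (α ⊕ (γ ⊕ δ)))) :
    ENNReal.ofReal (1 - Real.exp (-(κ / 192))) ≤
        minimaxProb (Fintype.card (α ⊕ (α ⊕ γ))) σ β ((σ : ℝ) ^ 2 * κ / (192 * n)) ∧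
      ENNReal.ofReal ((σ : ℝ) ^ 2 * κ / (24 * n)) ≤
        minimaxRisk (Fintype.card (α ⊕ (α ⊕ γ))) σ β := by
  -- Without noise there are no densities, but both thresholds vanish and the bounds are trivial.
  rcases eq_or_ne σ 0 with rfl | hσ
  · refine ⟨?_, by simp⟩
    obtain ⟨A, hA⟩ := symmetricOfRank_nonempty e
    refine le_iInf fun Ahat => ?_
    refine le_trans ?_ (le_iSup₂ (f := fun A _ => noiseLaw n 0 {z | ((0 : ℝ≥0) : ℝ) ^ 2 * κ /
      (192 * n) ≤ frobeniusSq (Ahat.1 (projections β A + z) - A)}) A hA)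
    simp only [NNReal.coe_zero, ne_eq, OfNat.ofNat_ne_zero, not_false_eq_true, zero_pow, zero_mul,
      zero_div, frobeniusSq_nonneg, Set.ofPred_true, measure_univ]
    rw [← ENNReal.ofReal_one]
    exact ENNReal.ofReal_le_ofReal (by linarith [Real.exp_pos (-(κ / 192))])
  set D : ℝ := ((Fintype.card (α × (α ⊕ (γ ⊕ δ))) : ℕ) : ℝ) with hD
  have hD1 : 1 ≤ D := Nat.one_le_cast.mpr hd
  have hD0 : 0 < D := by linarith
  have hn0 : (0 : ℝ) < n := by exact_mod_cast hn
  have hσ0 : (0 : ℝ) < σ := by exact_mod_cast pos_iff_ne_zero.mpr hσ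
  let v : ℝ≥0 := 5 / 2 * σ ^ 2 / n
  have hv : v ≠ 0 := by
    have : (n : ℝ≥0) ≠ 0 := by exact_mod_cast hn.ne'
    positivity
  have hvr : (v : ℝ) = 5 / 2 * (σ : ℝ) ^ 2 / n := by simp [v]
  -- Average posterior precision: at most `4n / σ²` from the data plus `1 / v = (2/5) n / σ²` from
  -- the prior.
  let H : ℝ := 22 / 5 * n / (σ : ℝ) ^ 2
  have hH : 0 < H := by positivity
  have htrace : (∑ i, ‖designVec e (β i)‖ ^ 2) / (σ : ℝ) ^ 2 + D / v ≤ D * H := by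
    have h1 : ∑ i, ‖designVec e (β i)‖ ^ 2 ≤ 4 * n * D := by
      simp_rw [norm_designVec_sq]
      rw [← Finset.mul_sum]
      linarith
    calc _ ≤ 4 * n * D / (σ : ℝ) ^ 2 + D / v := by gcongr
      _ = D * H := by
        rw [hvr]
        simp only [H]
        field_simp
        ring
  refine ⟨le_iInf fun Ahat => ?_, le_iInf fun Ahat => ?_⟩
  · set τ : ℝ := (σ : ℝ) ^ 2 * κ / (192 * n) with hτ
    -- Each coordinate then contributes `1/4`, and `D / 4 ≥ κ / 18` exceeds the cost `l * τ = (11/5)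
    -- κ / 192` by more than `κ / 192`.
    let l : ℝ := H / 2
    have hl : 0 < l := by positivity
    have key := one_le_iSup_lintegral_loss_add hσ hv β e hl hH htrace Ahat
      (φ := (Set.Ici τ).indicator 1) (c₁ := 1) (c₂ := Real.exp (l * τ)) (by simp)
      (Real.exp_pos _).le (by
        intro x _
        by_cases hx : τ ≤ x
        · rw [Set.indicator_of_mem (Set.mem_Ici.mpr hx)]
          simp
        · rw [Set.indicator_of_notMem (by simpa using hx), mul_zero, zero_add,
            ← ENNReal.ofReal_one]
          refine ENNReal.ofReal_le_ofReal ?_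
          rw [← Real.exp_add]
          refine Real.one_le_exp ?_
          nlinarith)
    rw [one_mul, ← hD] at key
    have hexp : Real.exp (l * τ) * Real.exp (-(D * (l / (H + 2 * l)))) ≤
        Real.exp (-(κ / 192)) := by
      rw [← Real.exp_add, Real.exp_le_exp]
      have h1 : l * τ = 11 / 5 * (κ / 192) := by
        simp only [l, H, hτ]
        field_simp
        ring
      have h2 : l / (H + 2 * l) = 1 / 4 := by
        simp only [l]
        field_simp
        ring
      rw [h1, h2]
      linarith
    rw [ENNReal.ofReal_sub _ (Real.exp_pos _).le, ENNReal.ofReal_one, tsub_le_iff_right]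
    refine key.trans (add_le_add (iSup₂_mono fun A _ => ?_) (ENNReal.ofReal_le_ofReal hexp))
    exact lintegral_indicator_one_le
      {z | τ ≤ frobeniusSq (Ahat.1 (projections β A + z) - A)}
  -- With `l` of order `1 / D` the total exponent is about `1/20`, so `1 ≤ l x + exp (-l x)` loses
  -- little: `l ρ ≥ 1/23`, and `(2/9) * (100/506) > 1/24`.
  · let l : ℝ := H / (20 * D)
    have hl : 0 < l := by positivity
    have key := one_le_iSup_lintegral_loss_add hσ hv β e hl hH htrace Ahat
      (φ := ENNReal.ofReal) (c₁ := ENNReal.ofReal l) (c₂ := 1) (by simp) zero_le_one (by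
        intro x hx
        rw [← ENNReal.ofReal_mul hl.le, ← ENNReal.ofReal_add (by positivity) (by positivity),
          ← ENNReal.ofReal_one]
        refine ENNReal.ofReal_le_ofReal ?_
        have := Real.add_one_le_exp (-l * x)
        linarith)
    rw [one_mul, ← hD] at key
    set R := ⨆ A ∈ symmetricOfRank p (Fintype.card (α ⊕ (α ⊕ γ))),
      ∫⁻ z, ENNReal.ofReal (frobeniusSq (Ahat.1 (projections β A + z) - A)) ∂(noiseLaw n σ)
    by_cases hR : R = ⊤
    · rw [hR]
      exact le_top
    set ρ := R.toReal
    have hRρ : R = ENNReal.ofReal ρ := (ENNReal.ofReal_toReal hR).symm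
    have hρ : 0 ≤ ρ := ENNReal.toReal_nonneg
    rw [hRρ] at key ⊢
    refine ENNReal.ofReal_le_ofReal ?_
    rw [← ENNReal.ofReal_mul hl.le, ← ENNReal.ofReal_add (by positivity) (by positivity),
      ENNReal.one_le_ofReal] at key
    have hq : D * (l / (H + 2 * l)) = D / (20 * D + 2) := by
      simp only [l]
      field_simp
    rw [hq] at key
    set q := D / (20 * D + 2) with hqdef
    have hq0 : 0 < q := by positivity
    have hexp : Real.exp (-q) ≤ 1 / (1 + q) := by
      rw [Real.exp_neg, ← one_div]
      exact one_div_le_one_div_of_le (by positivity) (by linarith [Real.add_one_le_exp q])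
    have h1 : q / (1 + q) ≤ l * ρ := by
      have : q / (1 + q) = 1 - 1 / (1 + q) := by field_simp; ring
      linarith
    have h2 : q / (1 + q) = D / (21 * D + 2) := by
      rw [hqdef]
      field_simp
      ring
    have h3 : D / (23 * D) ≤ q / (1 + q) := by
      rw [h2]
      gcongr
      linarith
    have h4 : 20 * D / (23 * H) ≤ ρ := by
      have h5 : 20 * D / (23 * H) * l = D / (23 * D) := by
        simp only [l]
        field_simp
      have h6 : 20 * D / (23 * H) * l ≤ ρ * l := by linarith
      exact le_of_mul_le_mul_right h6 hl
    refine le_trans ?_ h4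
    have h7 : 20 * D / (23 * H) = (σ : ℝ) ^ 2 * (100 / 506 * D) / n := by
      simp only [H]
      field_simp
      ring
    have h8 : (σ : ℝ) ^ 2 * κ / (24 * n) = (σ : ℝ) ^ 2 * (κ / 24) / n := by field_simp
    rw [h7, h8]
    gcongr
    linarith

end MinimaxBounds

/-- With `s = ⌊r/2⌋` the dimension is `s (p - s)`, and `p - s ≥ ⌊p/2⌋` since `2s ≤ p`. The ratio
`2/9` to `rp` is attained at `r = p = 3`. -/
theorem exists_block_indices {p r : ℕ} (hr : 2 ≤ r) (hrp : r ≤ p) :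
    ∃ (s q t : ℕ) (_ : Fin s ⊕ (Fin s ⊕ (Fin q ⊕ Fin t)) ≃ Fin p),
      Fintype.card (Fin s ⊕ (Fin s ⊕ Fin q)) = r ∧
      r / 2 * (p / 2) ≤ Fintype.card (Fin s × (Fin s ⊕ (Fin q ⊕ Fin t))) ∧
      2 * (r * p) ≤ 9 * Fintype.card (Fin s × (Fin s ⊕ (Fin q ⊕ Fin t))) := by
  refine ⟨r / 2, r % 2, p - r, Fintype.equivFinOfCardEq (by simp; omega), by simp; omega, ?_, ?_⟩
  · simp only [Fintype.card_prod, Fintype.card_sum, Fintype.card_fin]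
    exact Nat.mul_le_mul_left _ (by omega)
  · simp only [Fintype.card_prod, Fintype.card_sum, Fintype.card_fin]
    obtain ⟨m, rfl⟩ := Nat.exists_eq_add_of_le hrp
    obtain ⟨s, hs | hs⟩ := Nat.even_or_odd' r
    · subst hs
      have h1 : 2 * s / 2 = s := by omega
      have h2 : 2 * s % 2 = 0 := by omega
      have h3 : 2 * s + m - 2 * s = m := by omega
      rw [h1, h2, h3]
      nlinarith [Nat.zero_le (s * m), Nat.zero_le (s * s)]
    · subst hs
      have h1 : (2 * s + 1) / 2 = s := by omega
      have h2 : (2 * s + 1) % 2 = 1 := by omega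
      have h3 : 2 * s + 1 + m - (2 * s + 1) = m := by omega
      have h4 : 1 ≤ s := by omega
      rw [h1, h2, h3]
      nlinarith [Nat.mul_le_mul_right m h4, Nat.mul_le_mul_right s h4]

end SROP

end

theorem proposition2p4 :
    (∃ C : ℝ, 0 < C ∧ ∀ (n p r : ℕ) (σ : ℝ≥0), 2 ≤ p → 2 ≤ r → r ≤ p →
      C * (r : ℝ) * (p : ℝ) < (n : ℝ) →
      ∃ G : Set (Fin n → Fin p → ℝ), MeasurableSet G ∧
        ENNReal.ofReal (1 - 26 / (n : ℝ)) ≤ SROP.designLaw (gaussianReal 0 1) n p G ∧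
        ∀ β ∈ G,
          ENNReal.ofReal (1 - Real.exp (-((p : ℝ) * (r : ℝ) / 192))) ≤
            SROP.minimaxProb r σ β
              ((σ : ℝ) ^ 2 * (r : ℝ) * (p : ℝ) / (192 * (n : ℝ))) ∧
          ENNReal.ofReal ((σ : ℝ) ^ 2 * (r : ℝ) * (p : ℝ) / (24 * (n : ℝ))) ≤
            SROP.minimaxRisk r σ β) ∧
    (∀ (n p r : ℕ) (σ : ℝ≥0), 2 ≤ p → 2 ≤ r → r ≤ p → n < (r / 2) * (p / 2) →
      ∀ β : Fin n → Fin p → ℝ, SROP.minimaxRisk r σ β = ⊤) := by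
  -- `C = 1` suffices: the sample size condition serves only to make `n` positive.
  refine ⟨⟨1, one_pos, ?_⟩, ?_⟩
  · intro n p r σ hp hr hrp hnC
    obtain ⟨s, q, t, e, hcard, hn2, hd⟩ := SROP.exists_block_indices hr hrp
    have hn : 0 < n := by
      have h : (0 : ℝ) ≤ 1 * r * p := by positivity
      exact_mod_cast h.trans_lt hnC
    have hd0 : 0 < Fintype.card (Fin s × (Fin s ⊕ (Fin q ⊕ Fin t))) := by
      have : 0 < r * p := Nat.mul_pos (by omega) (by omega)
      omega
    refine ⟨{β | ∑ i, ∑ q : Fin s × (Fin s ⊕ (Fin q ⊕ Fin t)),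
      (β i (e (Sum.inl q.1)) * β i (e (Sum.inr q.2))) ^ 2 ≤
        2 * n * Fintype.card (Fin s × (Fin s ⊕ (Fin q ⊕ Fin t)))}, ?_, ?_, ?_⟩
    · exact measurableSet_le (by fun_prop) measurable_const
    · exact SROP.designLaw_energy_ge hn hd0 fun q h => by simpa using e.injective h
    · intro β hβ
      have hκ : 2 / 9 * ((r : ℝ) * p) ≤
          Fintype.card (Fin s × (Fin s ⊕ (Fin q ⊕ Fin t))) := by
        have : (2 : ℝ) * (r * p) ≤ 9 * Fintype.card (Fin s × (Fin s ⊕ (Fin q ⊕ Fin t))) := by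
          exact_mod_cast hd
        linarith
      have h := SROP.minimax_lower_bounds hn σ β e hd0 hκ hβ
      rw [hcard] at h
      rw [mul_comm (p : ℝ), mul_assoc]
      exact h
  · intro n p r σ hp hr hrp hn β
    obtain ⟨s, q, t, e, hcard, hn2, -⟩ := SROP.exists_block_indices hr hrp
    refine SROP.minimaxRisk_eq_top_of_far σ β fun N => ?_
    rw [← hcard]
    exact SROP.exists_projections_eq_far β e (hn.trans_le hn2) N
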